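/- Let $A$ be a C*-algebra (unital or not; for instance the C*-algebra underlying a C*-algebraic quantum group) with a faithful state $f$, that is, a positive linear functional $f\colon A\to\mathbb C$ with $\|f\|=1$ such that $f(a^*a)=0$ implies $a=0$. Let $E_1$ and $E_2$ be (right) Hilbert $A$-modules, with $A$-valued inner products $\langle\cdot,\cdot\rangle_{E_i}$ that are $A$-linear in the second entry, complete for the norms $\|x\|_{E_i}=\|\langle x,x\rangle_{E_i}\|^{1/2}$. Let $F\colon E_1\to E_2$ be a surjective $A$-linear map, i.e. $F$ is additive and $F(xa)=F(x)a$ for all $x\in E_1$, $a\in A$. Then the following four properties are equivalent: \begin{enumerate} \item $F$ is a unitary element of the bounded adjointable operators $\mathcal L(E_1,E_2)$: $F$ is bounded and linear and has a bounded linear adjoint $F^*\colon E_2\to E_1$, with $\langle Fx,y\rangle_{E_2}=\langle x,F^*y\rangle_{E_1}$ for all $x\in E_1$, $y\in E_2$, such that $F^*F=1_{E_1}$ and $FF^*=1_{E_2}$; \item $F$ is an isomorphism of Hilbert $A$-modules: $F$ is a $\mathbb C$-linear, $A$-linear bijection and $\langle x,y\rangle_{E_1}=\langle Fx,Fy\rangle_{E_2}$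 for all $x,y\in E_1$; \item $F$ is an isometry with respect to the norms on $E_1$ and $E_2$; \item $f(\langle x,y\rangle_{E_1})=f(\langle Fx,Fy\rangle_{E_2})$ for all $x,y\in E_1$. \end{enumerate} -/

import Mathlib

open scoped ComplexOrder RightActions

/-- An inner product module over a (possibly non-unital) C⋆-algebra `A`: a complex vector space `E`
with a right `A`-module structure (written `x <• a`) and an `A`-valued inner product which is
`A`-linear in the second entry, positive and definite; the norm of `E` is `‖x‖ = ‖⟪x, x⟫‖ ^ (1/2)`.
Mathlib's `CStarModule` uses a left action, with `⟪x, a • y⟫ = a * ⟪x, y⟫`.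
A (right) Hilbert `A`-module is an inner product module that is complete, i.e. `[CompleteSpace E]`. -/
class InnerProductModule (A E : Type*) [NonUnitalCStarAlgebra A] [PartialOrder A]
    [NormedAddCommGroup E] [NormedSpace ℂ E] [SMul Aᵐᵒᵖ E] extends Inner A E where
  add_rsmul (x y : E) (a : A) : (x + y) <• a = x <• a + y <• a
  rsmul_add (x : E) (a b : A) : x <• (a + b) = x <• a + x <• b
  rsmul_mul (x : E) (a b : A) : x <• (a * b) = (x <• a) <• b
  smul_rsmul (z : ℂ) (x : E) (a : A) : (z • x) <• a = z • (x <• a)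
  rsmul_smul (z : ℂ) (x : E) (a : A) : x <• (z • a) = z • (x <• a)
  inner_add_right (x y z : E) : inner x (y + z) = inner x y + inner x z
  inner_smul_right (z : ℂ) (x y : E) : inner x (z • y) = z • inner x y
  inner_rsmul_right (x y : E) (a : A) : inner x (y <• a) = inner x y * a
  star_inner (x y : E) : star (inner x y) = inner y x
  inner_self_nonneg (x : E) : 0 ≤ inner x x
  inner_self_eq_zero (x : E) : inner x x = 0 ↔ x = 0
  norm_eq_sqrt (x : E) : ‖x‖ = √‖inner x x‖

/-- A faithful state on a C⋆-algebra: a positive linear functional of norm one that vanishes on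
no nonzero positive element. -/
structure IsFaithfulState {A : Type*} [NonUnitalCStarAlgebra A] (f : A →L[ℂ] ℂ) : Prop where
  nonneg (a : A) : 0 ≤ f (star a * a)
  norm_eq_one : ‖f‖ = 1
  faithful (a : A) : f (star a * a) = 0 → a = 0

section Maps

variable (A : Type*) {E₁ E₂ : Type*} [NonUnitalCStarAlgebra A] [PartialOrder A]
  [NormedAddCommGroup E₁] [NormedSpace ℂ E₁] [SMul Aᵐᵒᵖ E₁] [InnerProductModule A E₁]
  [NormedAddCommGroup E₂] [NormedSpace ℂ E₂] [SMul Aᵐᵒᵖ E₂] [InnerProductModule A E₂]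

/-- `A`-linear maps of right `A`-modules. -/
structure IsModuleMap (F : E₁ → E₂) : Prop where
  map_add (x y : E₁) : F (x + y) = F x + F y
  map_rsmul (x : E₁) (a : A) : F (x <• a) = F x <• a

/-- `S` is the adjoint of `T`: `⟪T x, y⟫ = ⟪x, S y⟫` for all `x`, `y`. -/
def IsAdjoint (T : E₁ →L[ℂ] E₂) (S : E₂ →L[ℂ] E₁) : Prop :=
  ∀ (x : E₁) (y : E₂), inner A (T x) y = inner A x (S y)

variable (E₁ E₂) in
/-- The bounded adjointable operators `𝓛(E₁, E₂)`. -/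
def adjointableOperators : Set (E₁ →L[ℂ] E₂) :=
  {T | IsModuleMap A T ∧ ∃ S : E₂ →L[ℂ] E₁, IsModuleMap A S ∧ IsAdjoint A T S}

/-- `F` is a unitary element of `𝓛(E₁, E₂)`: it is (the underlying map of) a bounded adjointable
operator `U` whose adjoint `V` satisfies `V U = 1` and `U V = 1`. -/
def IsUnitaryOperator (F : E₁ → E₂) : Prop :=
  ∃ U ∈ adjointableOperators A E₁ E₂, ⇑U = F ∧
    ∃ V : E₂ →L[ℂ] E₁, IsAdjoint A U V ∧
      V.comp U = ContinuousLinearMap.id ℂ E₁ ∧ U.comp V = ContinuousLinearMap.id ℂ E₂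

/-- An isomorphism of Hilbert C⋆-modules: a linear bijection which is `A`-linear and preserves the
`A`-valued inner product. -/
structure IsHilbertModuleIso (F : E₁ → E₂) : Prop where
  linear : IsLinearMap ℂ F
  bijective : Function.Bijective F
  moduleMap : IsModuleMap A F
  inner_map (x y : E₁) : inner A x y = inner A (F x) (F y)

end Maps

/-! Each condition amounts to preservation of the `A`-valued inner product; bijectivity and
ℂ-linearity then come for free, and the inverse is the adjoint. For an isometry, `‖a⋆⟪x,x⟫a‖ = ‖xa‖²
= ‖(Fx)a‖² = ‖a⋆⟪Fx,Fx⟫a‖` for all `a`; such norms determine a positive element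
(`CStarAlgebra.eq_of_norm_star_mul_mul_eq`), and polarization finishes. For the state, replacing `y`
by `ya` shows that `f` kills `da`, where `d = ⟪x,y⟫ - ⟪Fx,Fy⟫`; faithfulness with `a = d⋆` gives `d
= 0`. -/

section ConjugationNorms

open scoped CStarAlgebra

theorem Unitization.exists_inr_eq_of_fst_eq_zero {R A : Type*} [Zero R] {t : Unitization R A}
    (ht : t.fst = 0) : ∃ a : A, (a : Unitization R A) = t :=
  ⟨t.snd, Unitization.ext (by simp [ht]) (by simp)⟩

variable {A : Type*} [NonUnitalCStarAlgebra A] [PartialOrder A] [StarOrderedRing A]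

/-- The order on positive elements of a C⋆-algebra is determined by the norms of their
conjugates, even if the algebra has no unit. -/
theorem CStarAlgebra.le_of_norm_star_mul_mul_le {p q : A} (hp : 0 ≤ p) (hq : 0 ≤ q)
    (h : ∀ a : A, ‖star a * p * a‖ ≤ ‖star a * q * a‖) : p ≤ q := by
  rw [← Unitization.inr_le_iff p q (.of_nonneg hp) (.of_nonneg hq)]
  have hP : (0 : A⁺¹) ≤ p := Unitization.inr_nonneg_iff.mpr hp
  have hQ : (0 : A⁺¹) ≤ q := Unitization.inr_nonneg_iff.mpr hq
  have norm_sqrt_mul_sq (r : A⁺¹) (hr : 0 ≤ r) (s : A⁺¹) :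
      ‖CFC.sqrt r * s‖ * ‖CFC.sqrt r * s‖ = ‖star s * r * s‖ := by
    rw [← CStarRing.norm_star_mul_self, star_mul,
      (IsSelfAdjoint.of_nonneg (CFC.sqrt_nonneg r)).star_eq, ← mul_assoc,
      mul_assoc (star s), CFC.sqrt_mul_sqrt_self r hr]
  -- With `b = (q + ε)^(-1/2)` and `t = √p b`, the claim is `‖t‖ ≤ 1`, while `q ≤ q + ε` gives `‖√q
  -- b‖ ≤ 1`.
  have key (ε : ℝ) (hε : 0 < ε) : (p : A⁺¹) ≤ q + algebraMap ℝ A⁺¹ ε := by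
    have hε' : IsStrictlyPositive (algebraMap ℝ A⁺¹ ε) :=
      ((isUnit_iff_ne_zero.mpr hε.ne').map _).isStrictlyPositive (algebraMap_nonneg _ hε.le)
    have hpos : IsStrictlyPositive ((q : A⁺¹) + algebraMap ℝ A⁺¹ ε) :=
      IsStrictlyPositive.nonneg_add hQ hε'
    have hQb := (le_iff_norm_sqrt_mul_rpow (q : A⁺¹) _ hQ hpos).mp
      (le_add_of_nonneg_right hε'.nonneg)
    rw [le_iff_norm_sqrt_mul_rpow _ _ hP hpos]
    set b : A⁺¹ := ((q : A⁺¹) + algebraMap ℝ A⁺¹ ε) ^ (-(1 / 2) : ℝ)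
    set t : A⁺¹ := CFC.sqrt (p : A⁺¹) * b with ht
    have hsqrt : (CFC.sqrt (p : A⁺¹)).fst = 0 := by
      have := congrArg (fun t : A⁺¹ ↦ t.fst) (CFC.sqrt_mul_sqrt_self (p : A⁺¹) hP)
      simpa using this
    -- The hypothesis only tests elements of `A`. Since `√p` has no scalar part, `b t⋆` is one, and
    -- `√p (b t⋆) = t t⋆` has norm `‖t‖²`.
    obtain ⟨a, ha⟩ := Unitization.exists_inr_eq_of_fst_eq_zero (t := b * star t)
      (by simp [ht, hsqrt])
    have hbound : ‖CFC.sqrt (p : A⁺¹) * a‖ ≤ ‖CFC.sqrt (q : A⁺¹) * a‖ := by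
      rw [mul_self_le_mul_self_iff (norm_nonneg _) (norm_nonneg _), norm_sqrt_mul_sq _ hP,
        norm_sqrt_mul_sq _ hQ]
      simpa only [← Unitization.inr_star, ← Unitization.inr_mul, Unitization.norm_inr] using h a
    have hle : ‖t‖ * ‖t‖ ≤ ‖t‖ :=
      calc ‖t‖ * ‖t‖ = ‖CFC.sqrt (p : A⁺¹) * a‖ := by
            rw [← CStarRing.norm_self_mul_star, ha, ← mul_assoc]
        _ ≤ ‖CFC.sqrt (q : A⁺¹) * b * star t‖ := by rwa [mul_assoc, ← ha]
        _ ≤ ‖CFC.sqrt (q : A⁺¹) * b‖ * ‖t‖ := by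
            simpa only [norm_star] using norm_mul_le (CFC.sqrt (q : A⁺¹) * b) (star t)
        _ ≤ ‖t‖ := mul_le_of_le_one_left (norm_nonneg _) hQb
    by_contra! hlt
    nlinarith
  have hlim : Filter.Tendsto (fun ε : ℝ ↦ (q : A⁺¹) + algebraMap ℝ A⁺¹ ε)
      (nhdsWithin 0 (Set.Ioi 0)) (nhds (q + algebraMap ℝ A⁺¹ 0)) :=
    ((continuous_const.add (continuous_algebraMap ℝ A⁺¹)).tendsto 0).mono_left
      nhdsWithin_le_nhds
  rw [map_zero, add_zero] at hlim
  exact ge_of_tendsto hlim (Filter.eventually_of_mem self_mem_nhdsWithin key)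

theorem CStarAlgebra.eq_of_norm_star_mul_mul_eq {p q : A} (hp : 0 ≤ p) (hq : 0 ≤ q)
    (h : ∀ a : A, ‖star a * p * a‖ = ‖star a * q * a‖) : p = q :=
  le_antisymm (le_of_norm_star_mul_mul_le hp hq fun a ↦ (h a).le)
    (le_of_norm_star_mul_mul_le hq hp fun a ↦ (h a).ge)

end ConjugationNorms

namespace InnerProductModule

variable {A E : Type*} [NonUnitalCStarAlgebra A] [PartialOrder A]
  [NormedAddCommGroup E] [NormedSpace ℂ E] [SMul Aᵐᵒᵖ E] [InnerProductModule A E]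

theorem inner_add_left (x y z : E) : inner A (x + y) z = inner A x z + inner A y z := by
  rw [← star_inner, inner_add_right, star_add, star_inner, star_inner]

theorem inner_smul_left (c : ℂ) (x y : E) : inner A (c • x) y = star c • inner A x y := by
  rw [← star_inner, inner_smul_right, star_smul, star_inner]

theorem inner_rsmul_left (x y : E) (a : A) : inner A (x <• a) y = star a * inner A x y := by
  rw [← star_inner, inner_rsmul_right, star_mul, star_inner]

variable (A) in
theorem norm_sq_eq (x : E) : ‖x‖ ^ 2 = ‖inner A x x‖ := by
  rw [norm_eq_sqrt (A := A), Real.sq_sqrt (norm_nonneg _)]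

theorem norm_rsmul_sq (x : E) (a : A) : ‖x <• a‖ ^ 2 = ‖star a * inner A x x * a‖ := by
  rw [norm_sq_eq A, inner_rsmul_right, inner_rsmul_left]

/-- The right action of `A` separates the points of `E`. -/
theorem eq_of_rsmul_eq {x y : E} (h : ∀ a : A, x <• a = y <• a) : x = y := by
  have hz (a : A) : inner A (x - y) ((x - y) <• a) = 0 := by
    have hsub : (x - y) <• a + y <• a = 0 + y <• a := by
      rw [← add_rsmul, sub_add_cancel, h, zero_add]
    have hzero : inner A (x - y) (0 : E) = 0 := by
      simpa using inner_smul_right (A := A) (0 : ℂ) (x - y) 0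
    rw [add_right_cancel hsub, hzero]
  -- For `z = x - y`, acting by `⟪z,z⟫` yields `⟪z,z⟫² = 0`, and `⟪z,z⟫` is self-adjoint.
  have hself := hz (inner A (x - y) (x - y))
  rw [inner_rsmul_right] at hself
  nth_rewrite 1 [← star_inner] at hself
  rwa [CStarRing.star_mul_self_eq_zero_iff, inner_self_eq_zero, sub_eq_zero] at hself

end InnerProductModule

open InnerProductModule

section ModuleMaps

variable {A E₁ E₂ : Type*} [NonUnitalCStarAlgebra A] [PartialOrder A]
  [NormedAddCommGroup E₁] [NormedSpace ℂ E₁] [SMul Aᵐᵒᵖ E₁] [InnerProductModule A E₁]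
  [NormedAddCommGroup E₂] [NormedSpace ℂ E₂] [SMul Aᵐᵒᵖ E₂] [InnerProductModule A E₂]
  {F : E₁ → E₂}

/-- Complex linearity of an `A`-linear map is automatic. -/
theorem IsModuleMap.isLinearMap (hF : IsModuleMap A F) : IsLinearMap ℂ F where
  map_add := hF.map_add
  -- After acting by `a`, the scalar can be absorbed into the algebra: `(cx)a = x(ca)`.
  map_smul c x := eq_of_rsmul_eq (A := A) fun a ↦ by
    rw [← hF.map_rsmul, smul_rsmul, smul_rsmul, ← rsmul_smul, ← rsmul_smul, hF.map_rsmul]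

/-- Polarization: a linear map which preserves `⟪x, x⟫` preserves the inner product. -/
theorem IsLinearMap.inner_map_of_inner_map_self (hF : IsLinearMap ℂ F)
    (h : ∀ x, inner A x x = inner A (F x) (F x)) (x y : E₁) :
    inner A x y = inner A (F x) (F y) := by
  have symm (x y : E₁) : inner A x y + inner A y x
      = inner A (F x) (F y) + inner A (F y) (F x) := by
    have hxy := h (x + y)
    rw [hF.map_add] at hxy
    simp only [InnerProductModule.inner_add_right, InnerProductModule.inner_add_left, ← h] at hxy
    linear_combination (norm := module) hxy
  have h₁ := symm x y
  -- The factors `i` and `-i` turn the symmetric sum into `⟪x,y⟫ - ⟪y,x⟫`, so adding `h₁` cancels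
  -- `⟪y,x⟫`.
  have h₂ := congrArg (fun a : A ↦ (-Complex.I) • a) (symm x (Complex.I • y))
  simp only [hF.map_smul, InnerProductModule.inner_smul_right,
    InnerProductModule.inner_smul_left, smul_add, smul_smul] at h₂
  simp only [Complex.star_def, Complex.conj_I, neg_mul, mul_neg, Complex.I_mul_I, neg_neg,
    one_smul, neg_smul] at h₂
  have h₃ : (2 : ℂ) • inner A x y = (2 : ℂ) • inner A (F x) (F y) := by
    rw [two_smul, two_smul]
    linear_combination (norm := module) h₁ + h₂
  exact smul_right_injective A two_ne_zero h₃

variable (A) in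
theorem norm_map_of_inner_map (h : ∀ x y, inner A x y = inner A (F x) (F y)) (x : E₁) :
    ‖F x‖ = ‖x‖ := by
  rw [norm_eq_sqrt (A := A) (F x), norm_eq_sqrt (A := A) x, h]

theorem IsModuleMap.isHilbertModuleIso (hF : IsModuleMap A F) (hsurj : Function.Surjective F)
    (h : ∀ x y, inner A x y = inner A (F x) (F y)) : IsHilbertModuleIso A F where
  linear := hF.isLinearMap
  bijective := ⟨(AddMonoidHomClass.isometry_of_norm (hF.isLinearMap.mk' F)
    (norm_map_of_inner_map A h)).injective, hsurj⟩
  moduleMap := hF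
  inner_map := h

theorem IsUnitaryOperator.inner_map (hF : IsUnitaryOperator A F) (x y : E₁) :
    inner A x y = inner A (F x) (F y) := by
  obtain ⟨U, -, rfl, V, hUV, hVU, -⟩ := hF
  rw [hUV, ← ContinuousLinearMap.comp_apply, hVU, ContinuousLinearMap.id_apply]

theorem IsHilbertModuleIso.isometry (hF : IsHilbertModuleIso A F) : Isometry F :=
  AddMonoidHomClass.isometry_of_norm (hF.linear.mk' F) (norm_map_of_inner_map A hF.inner_map)

theorem IsHilbertModuleIso.isUnitaryOperator (hF : IsHilbertModuleIso A F) :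
    IsUnitaryOperator A F := by
  let U : E₁ ≃ₗᵢ[ℂ] E₂ :=
    { LinearEquiv.ofBijective (hF.linear.mk' F) hF.bijective with
      norm_map' := norm_map_of_inner_map A hF.inner_map }
  have hU (x : E₁) : U x = F x := rfl
  let T : E₁ →L[ℂ] E₂ := U.toContinuousLinearEquiv
  let S : E₂ →L[ℂ] E₁ := U.symm.toContinuousLinearEquiv
  have hTS : IsAdjoint A T S := fun x y ↦ by
    change inner A (U x) y = inner A x (U.symm y)
    rw [hF.inner_map, ← hU, ← hU, U.apply_symm_apply]
  have hS : IsModuleMap A S :=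
    { map_add := S.map_add
      map_rsmul := fun y a ↦ hF.bijective.1 <| by
        change U (U.symm (y <• a)) = F (U.symm y <• a)
        rw [hF.moduleMap.map_rsmul, ← hU, U.apply_symm_apply, U.apply_symm_apply] }
  refine ⟨T, ⟨hF.moduleMap, S, hS, hTS⟩, rfl, S, hTS, ?_, ?_⟩
  · ext x
    exact U.symm_apply_apply x
  · ext y
    exact U.apply_symm_apply y

/-- An isometric `A`-linear map preserves the `A`-valued inner product. -/
theorem IsModuleMap.inner_map_of_isometry [StarOrderedRing A] (hF : IsModuleMap A F)
    (h : Isometry F) (x y : E₁) : inner A x y = inner A (F x) (F y) := by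
  have hnorm : ∀ x, ‖F x‖ = ‖x‖ :=
    (AddMonoidHomClass.isometry_iff_norm (hF.isLinearMap.mk' F)).mp h
  refine hF.isLinearMap.inner_map_of_inner_map_self (fun x ↦ ?_) x y
  refine CStarAlgebra.eq_of_norm_star_mul_mul_eq (inner_self_nonneg x) (inner_self_nonneg (F x))
    fun a ↦ ?_
  rw [← norm_rsmul_sq, ← norm_rsmul_sq, ← hF.map_rsmul, hnorm]

/-- An `A`-linear map which preserves the inner product after applying a faithful state preserves
the `A`-valued inner product. -/
theorem IsModuleMap.inner_map_of_faithfulState {f : A →L[ℂ] ℂ} (hf : IsFaithfulState f)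
    (hF : IsModuleMap A F) (h : ∀ x y, f (inner A x y) = f (inner A (F x) (F y))) (x y : E₁) :
    inner A x y = inner A (F x) (F y) := by
  have hmul (a : A) : f ((inner A x y - inner A (F x) (F y)) * a) = 0 := by
    have := h x (y <• a)
    rw [hF.map_rsmul, inner_rsmul_right, inner_rsmul_right] at this
    rw [sub_mul, map_sub, this, sub_self]
  have hz := hf.faithful (star (inner A x y - inner A (F x) (F y)))
    (by rw [star_star]; exact hmul _)
  rwa [star_eq_zero, sub_eq_zero] at hz

end ModuleMaps

theorem mainTheorem9 {A E₁ E₂ : Type*}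
    [NonUnitalCStarAlgebra A] [PartialOrder A] [StarOrderedRing A]
    [NormedAddCommGroup E₁] [NormedSpace ℂ E₁] [SMul Aᵐᵒᵖ E₁] [InnerProductModule A E₁]
    [CompleteSpace E₁]
    [NormedAddCommGroup E₂] [NormedSpace ℂ E₂] [SMul Aᵐᵒᵖ E₂] [InnerProductModule A E₂]
    [CompleteSpace E₂]
    (f : A →L[ℂ] ℂ) (hf : IsFaithfulState f)
    (F : E₁ → E₂) (hF : IsModuleMap A F) (hsurj : Function.Surjective F) :
    List.TFAE [
      IsUnitaryOperator A F,
      IsHilbertModuleIso A F,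
      Isometry F,
      ∀ x y : E₁, f (inner A x y) = f (inner A (F x) (F y))] := by
  tfae_have 1 → 2 := fun h ↦ hF.isHilbertModuleIso hsurj h.inner_map
  tfae_have 2 → 1 := IsHilbertModuleIso.isUnitaryOperator
  tfae_have 2 → 3 := IsHilbertModuleIso.isometry
  tfae_have 3 → 2 := fun h ↦ hF.isHilbertModuleIso hsurj (hF.inner_map_of_isometry h)
  tfae_have 2 → 4 := fun h x y ↦ by rw [h.inner_map]
  tfae_have 4 → 2 := fun h ↦ hF.isHilbertModuleIso hsurj (hF.inner_map_of_faithfulState hf h)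
  tfae_finish
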